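/- Definitions. For a semigroup $S$ with set of idempotents $E(S)$, write $a\,\mathcal R^*\,b$ if for all $x,y\in S^1$: $xa=ya\iff xb=yb$; $\mathcal L^*$ is the dual relation, and $\mathcal L,\mathcal R$ are Green's relations. $S$ is abundant if every $\mathcal R^*$-class and every $\mathcal L^*$-class contains an idempotent; an abundant semigroup is adequate if its idempotents commute, and quasi-adequate if its idempotents form a subsemigroup. In an adequate semigroup, $a^+$ and $a^*$ denote the unique idempotents in the $\mathcal R^*$-class and in the $\mathcal L^*$-class of $a$. An abundant subsemigroup $U$ of an abundant semigroup $S$ is a $*$-subsemigroup if $\mathcal R^*(U)$ and $\mathcal L^*(U)$ are the restrictions to $U$ of $\mathcal R^*(S)$ and $\mathcal L^*(S)$. An adequate $*$-subsemigroup $T$ of an abundant semigroup $S$ is an adequate transversal of $S$ if for each $x\in S$ there is a unique $\bar x\in T$ for which there exist $e,f\in E(S)$ with $x=e\bar xf$, $e\,\mathcal L\,\bar x^+$ and $f\,\mathcal R\,\bar x^*$. If $S$ is quasi-adequate, $T$ is admissible if $\overline{xy}=\bar x\,\bar y$ for all $x,y\in S$. $T$ is a quasi-ideal if $TST\subseteq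 T$. A band is left normal if $xyz=xzy$ identically and right normal if $xyz=yxz$ identically. A semilattice transversal of a band $B$ is a subsemilattice containing exactly one inverse of each $x\in B$ (an inverse of $x$ is an element $y$ with $xyx=x$ and $yxy=y$). Theorem. (1) Let $S^0$ be an adequate semigroup with semilattice of idempotents $E^0$, let $I$ be a left normal band and $\Lambda$ a right normal band, and suppose that $E^0$ is embedded in both $I$ and $\Lambda$ as a common semilattice transversal. For $x \in E^0$ let $L_x$ be the $\mathcal L$-class of $x$ in $I$ and $R_x$ the $\mathcal R$-class of $x$ in $\Lambda$. Put $$W=\{(e,x,f)\in I\times S^0\times\Lambda : e\in L_{x^+},\ f\in R_{x^*}\},\qquad (e,x,f)(g,y,h)=\bigl(e(xy)^+,\,xy,\,(xy)^*h\bigr).$$ Then this product is a well-defined associative operation on $W$, $W$ is a quasi-adequate semigroup, and $W^0=\{(x^+,x,x^*) : x\in S^0\}$ is a quasi-ideal, admissible adequate transversal of $W$, isomorphic to $S^0$ via $x\mapsto(x^+,x,x^*)$. (2) Conversely, every such transversal arises in this way: if $T$ is a quasi-ideal, admissible adequate transversal of a quasi-adequate semigroup $S$, then there exist a left normal band $I$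 and a right normal band $\Lambda$ with $E(T)$ embedded as a common semilattice transversal, such that, for the semigroup $W$ constructed as in (1) from $S^0=T$, $I$ and $\Lambda$, there is an isomorphism $S\to W$ that sends each $x\in T$ to $(x^+,x,x^*)$. -/

import Mathlib

universe u v w t

namespace AdequateTransversal

section Relations

variable {S : Type u} [Semigroup S]

/-- The relation `R*`: `a` and `b` have the same left-translation equalities
`x a = y a`, with `x, y` ranging over `S¹` (realised as `WithOne S`). -/
def RStar (a b : S) : Prop :=
  ∀ x y : WithOne S,
    x * (a : WithOne S) = y * (a : WithOne S) ↔ x * (b : WithOne S) = y * (b : WithOne S)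

/-- The relation `L*`, dual to `R*`. -/
def LStar (a b : S) : Prop :=
  ∀ x y : WithOne S,
    (a : WithOne S) * x = (a : WithOne S) * y ↔ (b : WithOne S) * x = (b : WithOne S) * y

/-- Green's relation `L`: `S¹ a = S¹ b`. -/
def GreenL (a b : S) : Prop :=
  (∃ x : WithOne S, (a : WithOne S) = x * (b : WithOne S)) ∧
    ∃ y : WithOne S, (b : WithOne S) = y * (a : WithOne S)

/-- Green's relation `R`: `a S¹ = b S¹`. -/
def GreenR (a b : S) : Prop :=
  (∃ x : WithOne S, (a : WithOne S) = (b : WithOne S) * x) ∧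
    ∃ y : WithOne S, (b : WithOne S) = (a : WithOne S) * y

/-- `y` is an inverse of `x`, i.e. `y ∈ V(x)`. -/
def IsInverseOf (x y : S) : Prop := x * y * x = x ∧ y * x * y = y

end Relations

/-- Every `R*`-class and every `L*`-class contains an idempotent. -/
def IsAbundant (S : Type u) [Semigroup S] : Prop :=
  ∀ a : S, (∃ e : S, IsIdempotentElem e ∧ RStar a e) ∧ ∃ e : S, IsIdempotentElem e ∧ LStar a e

/-- An adequate semigroup: abundant, with commuting idempotents. -/
structure IsAdequate (S : Type u) [Semigroup S] : Prop where
  abundant : IsAbundant S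
  comm : ∀ e f : S, IsIdempotentElem e → IsIdempotentElem f → e * f = f * e

/-- A quasi-adequate semigroup: abundant, and products of idempotents are idempotent. -/
structure IsQuasiAdequate (S : Type u) [Semigroup S] : Prop where
  abundant : IsAbundant S
  mul_idem : ∀ e f : S, IsIdempotentElem e → IsIdempotentElem f → IsIdempotentElem (e * f)

namespace IsAdequate

variable {S : Type u} [Semigroup S]

/-- The semilattice `E(S)` of idempotents of an adequate semigroup. -/
def idempotents (h : IsAdequate S) : Subsemigroup S where
  carrier := {e | IsIdempotentElem e}
  mul_mem' := fun {e f} he hf => IsIdempotentElem.mul_of_commute (h.comm e f he hf) he hf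

theorem existsUnique_plus (h : IsAdequate S) (a : S) :
    ∃! e : h.idempotents, RStar a (e : S) := by
  obtain ⟨e, he, hae⟩ := (h.abundant a).1
  refine ⟨⟨e, he⟩, hae, ?_⟩
  rintro ⟨f, hf⟩ (haf : RStar a f)
  have key1 := (haf 1 (e : WithOne S)).1 ((hae 1 (e : WithOne S)).2
    (by rw [one_mul, ← WithOne.coe_mul, he.eq]))
  have key2 := (hae 1 (f : WithOne S)).1 ((haf 1 (f : WithOne S)).2
    (by rw [one_mul, ← WithOne.coe_mul, IsIdempotentElem.eq hf]))
  rw [one_mul, ← WithOne.coe_mul, WithOne.coe_inj] at key1 key2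
  apply Subtype.ext
  change f = e
  rw [key1, h.comm e f he hf, ← key2]

theorem existsUnique_star (h : IsAdequate S) (a : S) :
    ∃! e : h.idempotents, LStar a (e : S) := by
  obtain ⟨e, he, hae⟩ := (h.abundant a).2
  refine ⟨⟨e, he⟩, hae, ?_⟩
  rintro ⟨f, hf⟩ (haf : LStar a f)
  have key1 := (haf 1 (e : WithOne S)).1 ((hae 1 (e : WithOne S)).2
    (by rw [mul_one, ← WithOne.coe_mul, he.eq]))
  have key2 := (hae 1 (f : WithOne S)).1 ((haf 1 (f : WithOne S)).2
    (by rw [mul_one, ← WithOne.coe_mul, IsIdempotentElem.eq hf]))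
  rw [mul_one, ← WithOne.coe_mul, WithOne.coe_inj] at key1 key2
  apply Subtype.ext
  change f = e
  rw [key1, h.comm f e hf he, ← key2]

/-- `a⁺`, the unique idempotent in the `R*`-class of `a`. -/
noncomputable def plus (h : IsAdequate S) (a : S) : h.idempotents :=
  (h.existsUnique_plus a).choose

/-- `a^*`, the unique idempotent in the `L*`-class of `a`. -/
noncomputable def star (h : IsAdequate S) (a : S) : h.idempotents :=
  (h.existsUnique_star a).choose

theorem plus_spec (h : IsAdequate S) (a : S) : RStar a (h.plus a : S) :=
  (h.existsUnique_plus a).choose_spec.1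

theorem star_spec (h : IsAdequate S) (a : S) : LStar a (h.star a : S) :=
  (h.existsUnique_star a).choose_spec.1

end IsAdequate

section Transversal

variable {S : Type u} [Semigroup S]

/-- An abundant subsemigroup `U` is a `*`-subsemigroup of `S` if `L*(U)` and `R*(U)` are the
restrictions to `U` of `L*(S)` and `R*(S)`. -/
structure IsStarSubsemigroup (U : Subsemigroup S) : Prop where
  abundant : IsAbundant U
  lStar_iff : ∀ a b : U, LStar a b ↔ LStar (a : S) (b : S)
  rStar_iff : ∀ a b : U, RStar a b ↔ RStar (a : S) (b : S)

/-- `T` is an adequate transversal of the abundant semigroup `S`: it is an adequate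
`*`-subsemigroup, and for every `x` there is a unique `y ∈ T` admitting idempotents `e, f` of `S`
with `x = e y f`, `e L y⁺` and `f R y^*` (Green's relations of `S`; `y⁺, y^*` taken in `T`). -/
structure IsAdequateTransversal (T : Subsemigroup S) : Prop where
  abundant : IsAbundant S
  adequate : IsAdequate T
  starSubsemigroup : IsStarSubsemigroup T
  existsUnique_bar : ∀ x : S, ∃! y : T, ∃ e f : S,
    IsIdempotentElem e ∧ IsIdempotentElem f ∧ x = e * (y : S) * f ∧
      GreenL e ((adequate.plus y : T) : S) ∧ GreenR f ((adequate.star y : T) : S)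

/-- The element of `T` attached to `x` by an adequate transversal `T` (written `x` with a bar). -/
noncomputable def IsAdequateTransversal.bar {T : Subsemigroup S} (hT : IsAdequateTransversal T)
    (x : S) : T :=
  (hT.existsUnique_bar x).choose

/-- The transversal is admissible if `x ↦ bar x` is multiplicative. -/
def IsAdequateTransversal.IsAdmissible {T : Subsemigroup S} (hT : IsAdequateTransversal T) : Prop :=
  ∀ x y : S, hT.bar (x * y) = hT.bar x * hT.bar y

/-- `T S T ⊆ T`. -/
def IsQuasiIdeal (T : Subsemigroup S) : Prop :=
  ∀ a ∈ T, ∀ s : S, ∀ b ∈ T, a * s * b ∈ T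

end Transversal

section Bands

/-- A left normal band: all elements are idempotent and `x y z = x z y`. -/
structure IsLeftNormalBand (B : Type u) [Semigroup B] : Prop where
  idem : ∀ x : B, IsIdempotentElem x
  left_normal : ∀ x y z : B, x * y * z = x * z * y

/-- A right normal band: all elements are idempotent and `x y z = y x z`. -/
structure IsRightNormalBand (B : Type u) [Semigroup B] : Prop where
  idem : ∀ x : B, IsIdempotentElem x
  right_normal : ∀ x y z : B, x * y * z = y * x * z

/-- A subsemigroup that is a semilattice and contains exactly one inverse of each element. -/
structure IsSemilatticeTransversal {B : Type u} [Semigroup B] (U : Subsemigroup B) : Prop where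
  idem : ∀ e ∈ U, IsIdempotentElem e
  comm : ∀ e ∈ U, ∀ f ∈ U, e * f = f * e
  existsUnique_inverse : ∀ x : B, ∃! y : B, y ∈ U ∧ IsInverseOf x y

/-- `p` identifies the semigroup `E` with a semilattice transversal of `B`. -/
structure EmbedsAsTransversal {E : Type u} {B : Type v} [Semigroup E] [Semigroup B]
    (p : E →ₙ* B) : Prop where
  injective : Function.Injective p
  transversal : IsSemilatticeTransversal p.srange

end Bands

section Construction

variable {S₀ : Type u} {I : Type v} {Λ : Type w} [Semigroup S₀] [Semigroup I] [Semigroup Λ]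

/-- The set `W` of triples `(e, x, f) ∈ I × S₀ × Λ` with `e L x⁺` in `I` and `f R x^*` in `Λ`, where
`p` and `q` embed the idempotents of `S₀` in `I` and `Λ`. -/
def tripleSet (h : IsAdequate S₀) (p : h.idempotents →ₙ* I) (q : h.idempotents →ₙ* Λ) :
    Set (I × S₀ × Λ) :=
  {w | GreenL w.1 (p (h.plus w.2.1)) ∧ GreenR w.2.2 (q (h.star w.2.1))}

/-- `(e, x, f) (g, y, k) = (e (xy)⁺, xy, (xy)^* k)`. -/
noncomputable def tripleMul (h : IsAdequate S₀) (p : h.idempotents →ₙ* I)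
    (q : h.idempotents →ₙ* Λ) (a b : I × S₀ × Λ) : I × S₀ × Λ :=
  (a.1 * p (h.plus (a.2.1 * b.2.1)), a.2.1 * b.2.1, q (h.star (a.2.1 * b.2.1)) * b.2.2)

/-- The triple `(x⁺, x, x^*)`. -/
noncomputable def baseTriple (h : IsAdequate S₀) (p : h.idempotents →ₙ* I)
    (q : h.idempotents →ₙ* Λ) (x : S₀) : I × S₀ × Λ :=
  (p (h.plus x), x, q (h.star x))

end Construction

end AdequateTransversal

/-! Part (1) rests on the middle coordinate `(e, x, f) ↦ x`, a homomorphism from `W` to `S₀`. A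
triple is idempotent exactly when its middle coordinate is, so the idempotents of `W` are closed
under products. `(e, x, f)` is `R*`-related to `(e, x⁺, x⁺)` and `L*`-related to `(x^*, x^*, f)`,
and the bar of a triple is the base triple over its middle coordinate (`existsFactorization_iff`).
Admissibility is then multiplicativity of the middle coordinate. The outer coordinates collapse
through `(xy)⁺ ≤ x⁺` and `(xy)^* ≤ y^*`.

For part (2), take as `I` the idempotents `L`-related to some element of `E(T)`, and as `Λ` those
`R`-related to one. The crux is `RightOver.mul_leftOver`: if `f R g` and `e L k` with `g, k ∈ E(T)`,
then `fe = gk`. Indeed `fe = g(fe)k` lies in `T` by the quasi-ideal property, so it equals its own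
bar, which is `gk` by admissibility. This yields closure and normality of both bands, and shows that
`(e, y, f) ↦ eyf` is a homomorphism: the inner factor `fe'` of a product may be replaced by `y^*
y'⁺`. Existence and uniqueness in the definition of a transversal, with cancellation by `R*` and
`L*`, make this map bijective. -/

namespace AdequateTransversal

/-! ### Green's relations and their starred versions -/

section Relations

variable {S : Type u} [Semigroup S]

theorem greenL_iff {a b : S} (ha : IsIdempotentElem a) (hb : IsIdempotentElem b) :
    GreenL a b ↔ a * b = a ∧ b * a = b := by
  constructor
  · rintro ⟨⟨x, hx⟩, y, hy⟩
    refine ⟨WithOne.coe_inj.1 ?_, WithOne.coe_inj.1 ?_⟩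
    · rw [WithOne.coe_mul, hx, mul_assoc, ← WithOne.coe_mul, hb.eq]
    · rw [WithOne.coe_mul, hy, mul_assoc, ← WithOne.coe_mul, ha.eq]
  · rintro ⟨h₁, h₂⟩
    exact ⟨⟨a, by rw [← WithOne.coe_mul, h₁]⟩, b, by rw [← WithOne.coe_mul, h₂]⟩

theorem greenR_iff {a b : S} (ha : IsIdempotentElem a) (hb : IsIdempotentElem b) :
    GreenR a b ↔ b * a = a ∧ a * b = b := by
  constructor
  · rintro ⟨⟨x, hx⟩, y, hy⟩
    refine ⟨WithOne.coe_inj.1 ?_, WithOne.coe_inj.1 ?_⟩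
    · rw [WithOne.coe_mul, hx, ← mul_assoc, ← WithOne.coe_mul, hb.eq]
    · rw [WithOne.coe_mul, hy, ← mul_assoc, ← WithOne.coe_mul, ha.eq]
  · rintro ⟨h₁, h₂⟩
    exact ⟨⟨a, by rw [← WithOne.coe_mul, h₁]⟩, b, by rw [← WithOne.coe_mul, h₂]⟩

/-- `R*` expressed without adjoining an identity. -/
theorem rStar_iff {a b : S} :
    RStar a b ↔ (∀ x y : S, x * a = y * a ↔ x * b = y * b) ∧ ∀ x : S, x * a = a ↔ x * b = b := by
  constructor
  · intro h
    refine ⟨fun x y => ?_, fun x => ?_⟩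
    · simpa only [← WithOne.coe_mul, WithOne.coe_inj] using h x y
    · simpa only [one_mul, ← WithOne.coe_mul, WithOne.coe_inj] using h x 1
  · rintro ⟨h₁, h₂⟩ x y
    cases x with
    | one =>
      cases y with
      | one => simp
      | coe y =>
        simpa only [one_mul, ← WithOne.coe_mul, WithOne.coe_inj, eq_comm] using h₂ y
    | coe x =>
      cases y with
      | one => simpa only [one_mul, ← WithOne.coe_mul, WithOne.coe_inj] using h₂ x
      | coe y => simpa only [← WithOne.coe_mul, WithOne.coe_inj] using h₁ x y

/-- `L*` expressed without adjoining an identity. -/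
theorem lStar_iff {a b : S} :
    LStar a b ↔ (∀ x y : S, a * x = a * y ↔ b * x = b * y) ∧ ∀ x : S, a * x = a ↔ b * x = b := by
  constructor
  · intro h
    refine ⟨fun x y => ?_, fun x => ?_⟩
    · simpa only [← WithOne.coe_mul, WithOne.coe_inj] using h x y
    · simpa only [mul_one, ← WithOne.coe_mul, WithOne.coe_inj] using h x 1
  · rintro ⟨h₁, h₂⟩ x y
    cases x with
    | one =>
      cases y with
      | one => simp
      | coe y =>
        simpa only [mul_one, ← WithOne.coe_mul, WithOne.coe_inj, eq_comm] using h₂ y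
    | coe x =>
      cases y with
      | one => simpa only [mul_one, ← WithOne.coe_mul, WithOne.coe_inj] using h₂ x
      | coe y => simpa only [← WithOne.coe_mul, WithOne.coe_inj] using h₁ x y

theorem RStar.symm {a b : S} (h : RStar a b) : RStar b a := fun x y => (h x y).symm

theorem RStar.trans {a b c : S} (h : RStar a b) (h' : RStar b c) : RStar a c :=
  fun x y => (h x y).trans (h' x y)

theorem LStar.symm {a b : S} (h : LStar a b) : LStar b a := fun x y => (h x y).symm

theorem LStar.trans {a b c : S} (h : LStar a b) (h' : LStar b c) : LStar a c :=
  fun x y => (h x y).trans (h' x y)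

theorem RStar.mul_left {a b : S} (h : RStar a b) (c : S) : RStar (c * a) (c * b) := by
  intro x y
  simpa only [WithOne.coe_mul, mul_assoc] using h (x * c) (y * c)

theorem LStar.mul_right {a b : S} (h : LStar a b) (c : S) : LStar (a * c) (b * c) := by
  intro x y
  simpa only [WithOne.coe_mul, mul_assoc] using h (c * x) (c * y)

/-- Fewer multipliers have to be tested in `U`. The converse fails in general and is the real
content of being a `*`-subsemigroup. -/
theorem RStar.restrict {U : Subsemigroup S} {a b : U} (h : RStar (a : S) (b : S)) : RStar a b := by
  rw [rStar_iff] at h ⊢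
  simp only [Subtype.ext_iff, MulMemClass.coe_mul]
  exact ⟨fun x y => h.1 x y, fun x => h.2 x⟩

theorem LStar.restrict {U : Subsemigroup S} {a b : U} (h : LStar (a : S) (b : S)) : LStar a b := by
  rw [lStar_iff] at h ⊢
  simp only [Subtype.ext_iff, MulMemClass.coe_mul]
  exact ⟨fun x y => h.1 x y, fun x => h.2 x⟩

variable {S' : Type v} [Semigroup S']

theorem RStar.map {a b : S} (h : RStar a b) (ψ : S ≃* S') : RStar (ψ a) (ψ b) := by
  rw [rStar_iff] at h ⊢
  refine ⟨fun x y => ?_, fun x => ?_⟩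
  · obtain ⟨x, rfl⟩ := ψ.surjective x
    obtain ⟨y, rfl⟩ := ψ.surjective y
    simpa only [← map_mul, ψ.injective.eq_iff] using h.1 x y
  · obtain ⟨x, rfl⟩ := ψ.surjective x
    simpa only [← map_mul, ψ.injective.eq_iff] using h.2 x

theorem LStar.map {a b : S} (h : LStar a b) (ψ : S ≃* S') : LStar (ψ a) (ψ b) := by
  rw [lStar_iff] at h ⊢
  refine ⟨fun x y => ?_, fun x => ?_⟩
  · obtain ⟨x, rfl⟩ := ψ.surjective x
    obtain ⟨y, rfl⟩ := ψ.surjective y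
    simpa only [← map_mul, ψ.injective.eq_iff] using h.1 x y
  · obtain ⟨x, rfl⟩ := ψ.surjective x
    simpa only [← map_mul, ψ.injective.eq_iff] using h.2 x

end Relations

/-! ### Calculus of `a⁺` and `a^*` in an adequate semigroup -/

namespace IsAdequate

variable {S : Type u} [Semigroup S] (h : IsAdequate S)

theorem idempotents_mul_comm (e f : h.idempotents) : e * f = f * e :=
  Subtype.ext (h.comm e f e.2 f.2)

theorem idempotents_mul_self (e : h.idempotents) : e * e = e :=
  Subtype.ext (IsIdempotentElem.eq e.2)

theorem plus_eq {a : S} {e : h.idempotents} (hae : RStar a e) : h.plus a = e :=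
  (h.existsUnique_plus a).unique (h.plus_spec a) hae

theorem star_eq {a : S} {e : h.idempotents} (hae : LStar a e) : h.star a = e :=
  (h.existsUnique_star a).unique (h.star_spec a) hae

theorem plus_coe (e : h.idempotents) : h.plus (e : S) = e := h.plus_eq fun _ _ => Iff.rfl

theorem star_coe (e : h.idempotents) : h.star (e : S) = e := h.star_eq fun _ _ => Iff.rfl

theorem mul_plus_inj {a x y : S} : x * a = y * a ↔ x * (h.plus a : S) = y * h.plus a :=
  (rStar_iff.1 (h.plus_spec a)).1 x y

theorem mul_star_inj {a x y : S} : a * x = a * y ↔ (h.star a : S) * x = h.star a * y :=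
  (lStar_iff.1 (h.star_spec a)).1 x y

theorem mul_plus_eq_plus {a x : S} : x * a = a ↔ x * (h.plus a : S) = h.plus a :=
  (rStar_iff.1 (h.plus_spec a)).2 x

theorem mul_star_eq_star {a x : S} : a * x = a ↔ (h.star a : S) * x = h.star a :=
  (lStar_iff.1 (h.star_spec a)).2 x

theorem plus_mul_self (a : S) : (h.plus a : S) * a = a :=
  h.mul_plus_eq_plus.2 (IsIdempotentElem.eq (h.plus a).2)

theorem mul_star_self (a : S) : a * (h.star a : S) = a :=
  h.mul_star_eq_star.2 (IsIdempotentElem.eq (h.star a).2)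

/-- `a⁺` fixes `ab` on the left, hence fixes `(ab)⁺`; in the semilattice order, `(ab)⁺ ≤ a⁺`. -/
theorem plus_mul_plus_mul (a b : S) : h.plus a * h.plus (a * b) = h.plus (a * b) :=
  Subtype.ext (h.mul_plus_eq_plus.1 (by rw [← mul_assoc, h.plus_mul_self]))

theorem star_mul_mul_star (a b : S) : h.star (a * b) * h.star b = h.star (a * b) :=
  Subtype.ext (h.mul_star_eq_star.1 (by rw [mul_assoc, h.mul_star_self]))

/-- `R*` is a left congruence, so `b` may be replaced by `b⁺` without changing the `R*`-class of the
product. -/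
theorem plus_mul_plus (a b : S) : h.plus (a * (h.plus b : S)) = h.plus (a * b) :=
  h.plus_eq (((h.plus_spec b).mul_left a).symm.trans (h.plus_spec (a * b)))

theorem star_star_mul (a b : S) : h.star ((h.star a : S) * b) = h.star (a * b) :=
  h.star_eq (((h.star_spec a).mul_right b).symm.trans (h.star_spec (a * b)))

variable {S' : Type v} [Semigroup S']

theorem of_mulEquiv (h : IsAdequate S) (ψ : S ≃* S') : IsAdequate S' where
  abundant := by
    intro a
    obtain ⟨a, rfl⟩ := ψ.surjective a
    exact ⟨⟨ψ (h.plus a), (h.plus a).2.map ψ, (h.plus_spec a).map ψ⟩,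
      ψ (h.star a), (h.star a).2.map ψ, (h.star_spec a).map ψ⟩
  comm := by
    intro e f he hf
    obtain ⟨e, rfl⟩ := ψ.surjective e
    obtain ⟨f, rfl⟩ := ψ.surjective f
    rw [← map_mul, ← map_mul]
    refine congrArg ψ (h.comm e f ?_ ?_)
    · exact ψ.injective (by rw [map_mul]; exact he)
    · exact ψ.injective (by rw [map_mul]; exact hf)

theorem plus_map (h' : IsAdequate S') (ψ : S ≃* S') (a : S) :
    (h'.plus (ψ a) : S') = ψ (h.plus a) :=
  congrArg Subtype.val
    (h'.plus_eq (e := ⟨ψ (h.plus a), (h.plus a).2.map ψ⟩) ((h.plus_spec a).map ψ))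

theorem star_map (h' : IsAdequate S') (ψ : S ≃* S') (a : S) :
    (h'.star (ψ a) : S') = ψ (h.star a) :=
  congrArg Subtype.val
    (h'.star_eq (e := ⟨ψ (h.star a), (h.star a).2.map ψ⟩) ((h.star_spec a).map ψ))

end IsAdequate

/-! ### The semigroup of triples and its transversal -/

section Construction

variable {S₀ : Type u} {I : Type v} {Λ : Type w} [Semigroup S₀] [Semigroup I] [Semigroup Λ]
  {h : IsAdequate S₀} {p : h.idempotents →ₙ* I} {q : h.idempotents →ₙ* Λ}

theorem IsAdequate.map_idem {B : Type v} [Semigroup B] (p : h.idempotents →ₙ* B)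
    (e : h.idempotents) : p e * p e = p e := by
  rw [← map_mul, h.idempotents_mul_self]

theorem mem_tripleSet (hI : IsLeftNormalBand I) (hΛ : IsRightNormalBand Λ) {w : I × S₀ × Λ} :
    w ∈ tripleSet h p q ↔
      (w.1 * p (h.plus w.2.1) = w.1 ∧ p (h.plus w.2.1) * w.1 = p (h.plus w.2.1)) ∧
        q (h.star w.2.1) * w.2.2 = w.2.2 ∧ w.2.2 * q (h.star w.2.1) = q (h.star w.2.1) :=
  and_congr (greenL_iff (hI.idem _) (hI.idem _)) (greenR_iff (hΛ.idem _) (hΛ.idem _))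

theorem tripleMul_mem (hI : IsLeftNormalBand I) (hΛ : IsRightNormalBand Λ) {a b : I × S₀ × Λ}
    (ha : a ∈ tripleSet h p q) (hb : b ∈ tripleSet h p q) :
    tripleMul h p q a b ∈ tripleSet h p q := by
  obtain ⟨e, x, f⟩ := a
  obtain ⟨g, y, k⟩ := b
  rw [mem_tripleSet hI hΛ] at ha hb ⊢
  obtain ⟨⟨-, h₁⟩, -⟩ := ha
  obtain ⟨-, -, h₂⟩ := hb
  simp only [tripleMul] at *
  refine ⟨⟨?_, ?_⟩, ?_, ?_⟩
  · rw [mul_assoc, h.map_idem]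
  -- Left normality reduces the product to `(xy)⁺ e`. Writing `(xy)⁺ = (xy)⁺ x⁺` then lets `x⁺ e =
  -- x⁺` absorb `e`.
  · rw [← mul_assoc, hI.left_normal, h.map_idem, ← h.plus_mul_plus_mul, h.idempotents_mul_comm,
      map_mul, mul_assoc, h₁]
  · rw [← mul_assoc, h.map_idem]
  · rw [hΛ.right_normal, mul_assoc, h.map_idem, ← h.star_mul_mul_star, h.idempotents_mul_comm,
      map_mul, ← mul_assoc, h₂]

theorem tripleMul_assoc (a b c : I × S₀ × Λ) :
    tripleMul h p q (tripleMul h p q a b) c = tripleMul h p q a (tripleMul h p q b c) := by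
  simp only [tripleMul, Prod.mk.injEq]
  refine ⟨?_, mul_assoc _ _ _, ?_⟩
  · rw [mul_assoc, ← map_mul, h.plus_mul_plus_mul, mul_assoc]
  · rw [← mul_assoc, ← map_mul, mul_assoc, h.star_mul_mul_star]

theorem baseTriple_mem (x : S₀) : baseTriple h p q x ∈ tripleSet h p q :=
  ⟨⟨⟨1, (one_mul _).symm⟩, 1, (one_mul _).symm⟩, ⟨1, (mul_one _).symm⟩, 1, (mul_one _).symm⟩

theorem tripleMul_baseTriple (x y : S₀) :
    tripleMul h p q (baseTriple h p q x) (baseTriple h p q y) = baseTriple h p q (x * y) := by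
  simp only [tripleMul, baseTriple, ← map_mul, h.plus_mul_plus_mul, h.star_mul_mul_star]

/-- The semigroup structure on the set of triples. -/
noncomputable abbrev tripleSemigroup (hI : IsLeftNormalBand I) (hΛ : IsRightNormalBand Λ)
    (p : h.idempotents →ₙ* I) (q : h.idempotents →ₙ* Λ) : Semigroup (tripleSet h p q) where
  mul a b := ⟨tripleMul h p q a b, tripleMul_mem hI hΛ a.2 b.2⟩
  mul_assoc a b c := Subtype.ext (tripleMul_assoc (a : I × S₀ × Λ) b c)

theorem plusTriple_mem {w : I × S₀ × Λ} (hw : w ∈ tripleSet h p q) :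
    (w.1, (h.plus w.2.1 : S₀), q (h.plus w.2.1)) ∈ tripleSet h p q := by
  refine ⟨?_, ?_⟩
  · simpa only [h.plus_coe] using hw.1
  · simpa only [baseTriple, h.star_coe] using
      (baseTriple_mem (p := p) (q := q) (h.plus w.2.1 : S₀)).2

theorem starTriple_mem {w : I × S₀ × Λ} (hw : w ∈ tripleSet h p q) :
    (p (h.star w.2.1), (h.star w.2.1 : S₀), w.2.2) ∈ tripleSet h p q := by
  refine ⟨?_, ?_⟩
  · simpa only [baseTriple, h.plus_coe] using
      (baseTriple_mem (p := p) (q := q) (h.star w.2.1 : S₀)).1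
  · simpa only [h.star_coe] using hw.2

/-- The triple `(e, x⁺, x⁺)` attached to `(e, x, f)`. -/
noncomputable def plusTriple (w : tripleSet h p q) : tripleSet h p q :=
  ⟨_, plusTriple_mem w.2⟩

/-- The triple `(x^*, x^*, f)` attached to `(e, x, f)`. -/
noncomputable def starTriple (w : tripleSet h p q) : tripleSet h p q :=
  ⟨_, starTriple_mem w.2⟩

/-- The triple `(x⁺, x, x^*)` as a member of the set of triples. -/
noncomputable def baseElem (p : h.idempotents →ₙ* I) (q : h.idempotents →ₙ* Λ) (x : S₀) :
    tripleSet h p q :=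
  ⟨baseTriple h p q x, baseTriple_mem x⟩

theorem plusTriple_baseElem (x : S₀) :
    plusTriple (baseElem p q x) = baseElem p q (h.plus x : S₀) := by
  apply Subtype.ext
  simp only [plusTriple, baseElem, baseTriple, h.plus_coe, h.star_coe]

theorem starTriple_baseElem (x : S₀) :
    starTriple (baseElem p q x) = baseElem p q (h.star x : S₀) := by
  apply Subtype.ext
  simp only [starTriple, baseElem, baseTriple, h.plus_coe, h.star_coe]

variable [Semigroup (tripleSet h p q)]

/-- Multiplying on the left by `(g, y, k)` gives the same first coordinate for both triples, as
`(yx⁺)⁺ = (yx)⁺`. Middle coordinates are compared through `x R* x⁺`, and equality of third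
coordinates follows from equality of the middle ones. -/
theorem rStar_plusTriple (hI : IsLeftNormalBand I) (hΛ : IsRightNormalBand Λ)
    (hmul : ∀ a b : tripleSet h p q,
      ((a * b : tripleSet h p q) : I × S₀ × Λ) = tripleMul h p q a b)
    (w : tripleSet h p q) : RStar w (plusTriple w) := by
  obtain ⟨⟨e, x, f⟩, hw⟩ := w
  have hw' := (mem_tripleSet hI hΛ).1 hw
  obtain ⟨⟨-, -⟩, h₁, -⟩ := hw'
  simp only at h₁
  refine rStar_iff.2 ⟨?_, ?_⟩
  · rintro ⟨⟨g, y, k⟩, ha⟩ ⟨⟨g', z, k'⟩, hb⟩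
    simp only [Subtype.ext_iff, hmul, plusTriple, tripleMul, Prod.mk.injEq, h.plus_mul_plus]
    rw [← h.mul_plus_inj]
    refine and_congr_right fun _ => ⟨fun H => ⟨H.1, ?_⟩, fun H => ⟨H.1, by rw [H.1]⟩⟩
    rw [h.mul_plus_inj.1 H.1]
  · rintro ⟨⟨g, y, k⟩, ha⟩
    simp only [Subtype.ext_iff, hmul, plusTriple, tripleMul, Prod.mk.injEq, h.plus_mul_plus]
    rw [← h.mul_plus_eq_plus]
    refine and_congr_right fun _ => ⟨fun H => ⟨H.1, ?_⟩, fun H => ⟨H.1, by rw [H.1, h₁]⟩⟩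
    rw [h.mul_plus_eq_plus.1 H.1, h.star_coe, h.map_idem]

theorem lStar_starTriple (hI : IsLeftNormalBand I) (hΛ : IsRightNormalBand Λ)
    (hmul : ∀ a b : tripleSet h p q,
      ((a * b : tripleSet h p q) : I × S₀ × Λ) = tripleMul h p q a b)
    (w : tripleSet h p q) : LStar w (starTriple w) := by
  obtain ⟨⟨e, x, f⟩, hw⟩ := w
  have hw' := (mem_tripleSet hI hΛ).1 hw
  obtain ⟨⟨h₁, -⟩, -, -⟩ := hw'
  simp only at h₁
  refine lStar_iff.2 ⟨?_, ?_⟩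
  · rintro ⟨⟨g, y, k⟩, ha⟩ ⟨⟨g', z, k'⟩, hb⟩
    simp only [Subtype.ext_iff, hmul, starTriple, tripleMul, Prod.mk.injEq, h.star_star_mul]
    rw [← h.mul_star_inj, ← and_assoc, ← and_assoc]
    refine and_congr_left fun _ => ⟨fun H => ⟨?_, H.2⟩, fun H => ⟨by rw [H.2], H.2⟩⟩
    rw [h.mul_star_inj.1 H.2]
  · rintro ⟨⟨g, y, k⟩, ha⟩
    simp only [Subtype.ext_iff, hmul, starTriple, tripleMul, Prod.mk.injEq, h.star_star_mul]
    rw [← h.mul_star_eq_star, ← and_assoc, ← and_assoc]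
    refine and_congr_left fun _ => ⟨fun H => ⟨?_, H.2⟩, fun H => ⟨by rw [H.2, h₁], H.2⟩⟩
    rw [h.mul_star_eq_star.1 H.2, h.plus_coe, h.map_idem]

theorem isIdempotentElem_triple_iff (hI : IsLeftNormalBand I) (hΛ : IsRightNormalBand Λ)
    (hmul : ∀ a b : tripleSet h p q,
      ((a * b : tripleSet h p q) : I × S₀ × Λ) = tripleMul h p q a b)
    (w : tripleSet h p q) : IsIdempotentElem w ↔ IsIdempotentElem (w : I × S₀ × Λ).2.1 := by
  obtain ⟨⟨e, x, f⟩, hw⟩ := w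
  obtain ⟨⟨h₁, -⟩, h₂, -⟩ := (mem_tripleSet hI hΛ).1 hw
  simp only [IsIdempotentElem, Subtype.ext_iff, hmul, tripleMul, Prod.mk.injEq] at *
  exact ⟨fun H => H.2.1, fun H => ⟨by rw [H, h₁], H, by rw [H, h₂]⟩⟩

theorem isIdempotentElem_plusTriple (hI : IsLeftNormalBand I) (hΛ : IsRightNormalBand Λ)
    (hmul : ∀ a b : tripleSet h p q,
      ((a * b : tripleSet h p q) : I × S₀ × Λ) = tripleMul h p q a b)
    (w : tripleSet h p q) : IsIdempotentElem (plusTriple w) :=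
  (isIdempotentElem_triple_iff hI hΛ hmul _).2 (h.plus _).2

theorem isIdempotentElem_starTriple (hI : IsLeftNormalBand I) (hΛ : IsRightNormalBand Λ)
    (hmul : ∀ a b : tripleSet h p q,
      ((a * b : tripleSet h p q) : I × S₀ × Λ) = tripleMul h p q a b)
    (w : tripleSet h p q) : IsIdempotentElem (starTriple w) :=
  (isIdempotentElem_triple_iff hI hΛ hmul _).2 (h.star _).2

theorem isQuasiAdequate_tripleSet (hI : IsLeftNormalBand I) (hΛ : IsRightNormalBand Λ)
    (hmul : ∀ a b : tripleSet h p q,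
      ((a * b : tripleSet h p q) : I × S₀ × Λ) = tripleMul h p q a b) :
    IsQuasiAdequate (tripleSet h p q) where
  abundant w := ⟨⟨_, isIdempotentElem_plusTriple hI hΛ hmul w, rStar_plusTriple hI hΛ hmul w⟩,
    _, isIdempotentElem_starTriple hI hΛ hmul w, lStar_starTriple hI hΛ hmul w⟩
  mul_idem e f he hf := by
    rw [isIdempotentElem_triple_iff hI hΛ hmul] at *
    rw [hmul]
    exact h.idempotents.mul_mem he hf

/-- The embedding `x ↦ (x⁺, x, x^*)`. -/
noncomputable def baseHom (hmul : ∀ a b : tripleSet h p q,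
    ((a * b : tripleSet h p q) : I × S₀ × Λ) = tripleMul h p q a b) :
    S₀ →ₙ* tripleSet h p q where
  toFun := baseElem p q
  map_mul' x y := Subtype.ext (by rw [hmul]; exact (tripleMul_baseTriple x y).symm)

theorem baseHom_injective (hmul : ∀ a b : tripleSet h p q,
    ((a * b : tripleSet h p q) : I × S₀ × Λ) = tripleMul h p q a b) :
    Function.Injective (baseHom hmul) :=
  fun _ _ H => congrArg (fun w : tripleSet h p q => (w : I × S₀ × Λ).2.1) H

/-- `S₀` is isomorphic to the subsemigroup of the triples `(x⁺, x, x^*)`. -/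
noncomputable def baseEquiv (hmul : ∀ a b : tripleSet h p q,
    ((a * b : tripleSet h p q) : I × S₀ × Λ) = tripleMul h p q a b) :
    S₀ ≃* (baseHom hmul).srange :=
  MulEquiv.ofBijective (baseHom hmul).srangeRestrict
    ⟨fun _ _ H => baseHom_injective hmul (congrArg Subtype.val H),
      (baseHom hmul).srangeRestrict_surjective⟩

theorem coe_baseEquiv (hmul : ∀ a b : tripleSet h p q,
    ((a * b : tripleSet h p q) : I × S₀ × Λ) = tripleMul h p q a b) (x : S₀) :
    (baseEquiv hmul x : tripleSet h p q) = baseElem p q x := rfl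

/-- Base triples that are `L*`-related inside the subsemigroup have the same `x^*`, so in all of `W`
both are `L*`-related to the base triple of `x^*`; dually for `R*`. -/
theorem isStarSubsemigroup_baseHom (hI : IsLeftNormalBand I) (hΛ : IsRightNormalBand Λ)
    (hmul : ∀ a b : tripleSet h p q,
      ((a * b : tripleSet h p q) : I × S₀ × Λ) = tripleMul h p q a b) :
    IsStarSubsemigroup (baseHom hmul).srange where
  abundant := (h.of_mulEquiv (baseEquiv hmul)).abundant
  lStar_iff a b := by
    refine ⟨fun H => ?_, LStar.restrict⟩
    obtain ⟨x, rfl⟩ := (baseEquiv hmul).surjective a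
    obtain ⟨y, rfl⟩ := (baseEquiv hmul).surjective b
    have H' := H.map (baseEquiv hmul).symm
    rw [MulEquiv.symm_apply_apply, MulEquiv.symm_apply_apply] at H'
    have hxy : h.star x = h.star y := h.star_eq (H'.trans (h.star_spec y))
    have hx := lStar_starTriple hI hΛ hmul (baseElem p q x)
    have hy := lStar_starTriple hI hΛ hmul (baseElem p q y)
    rw [starTriple_baseElem] at hx hy
    rw [hxy] at hx
    exact hx.trans hy.symm
  rStar_iff a b := by
    refine ⟨fun H => ?_, RStar.restrict⟩
    obtain ⟨x, rfl⟩ := (baseEquiv hmul).surjective a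
    obtain ⟨y, rfl⟩ := (baseEquiv hmul).surjective b
    have H' := H.map (baseEquiv hmul).symm
    rw [MulEquiv.symm_apply_apply, MulEquiv.symm_apply_apply] at H'
    have hxy : h.plus x = h.plus y := h.plus_eq (H'.trans (h.plus_spec y))
    have hx := rStar_plusTriple hI hΛ hmul (baseElem p q x)
    have hy := rStar_plusTriple hI hΛ hmul (baseElem p q y)
    rw [plusTriple_baseElem] at hx hy
    rw [hxy] at hx
    exact hx.trans hy.symm

theorem isIdempotentElem_baseElem (hI : IsLeftNormalBand I) (hΛ : IsRightNormalBand Λ)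
    (hmul : ∀ a b : tripleSet h p q,
      ((a * b : tripleSet h p q) : I × S₀ × Λ) = tripleMul h p q a b)
    (e : h.idempotents) : IsIdempotentElem (baseElem p q (e : S₀)) :=
  (isIdempotentElem_triple_iff hI hΛ hmul _).2 e.2

/-- The middle coordinate of `w` is the only candidate for the element attached to `w`. -/
theorem existsFactorization_iff (hI : IsLeftNormalBand I) (hΛ : IsRightNormalBand Λ)
    (hmul : ∀ a b : tripleSet h p q,
      ((a * b : tripleSet h p q) : I × S₀ × Λ) = tripleMul h p q a b)
    (w : tripleSet h p q) (y : S₀) :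
    (∃ e f : tripleSet h p q, IsIdempotentElem e ∧ IsIdempotentElem f ∧
      w = e * baseElem p q y * f ∧ GreenL e (baseElem p q (h.plus y : S₀)) ∧
        GreenR f (baseElem p q (h.star y : S₀))) ↔ y = (w : I × S₀ × Λ).2.1 := by
  constructor
  · rintro ⟨e, f, he, hf, hw, hL, hR⟩
    rw [greenL_iff he (isIdempotentElem_baseElem hI hΛ hmul _)] at hL
    rw [greenR_iff hf (isIdempotentElem_baseElem hI hΛ hmul _)] at hR
    have mid : ∀ {a b : tripleSet h p q}, a = b →
      (a : I × S₀ × Λ).2.1 = (b : I × S₀ × Λ).2.1 := fun H => by rw [H]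
    have hw := mid hw
    have hL₁ := mid hL.1
    have hL₂ := mid hL.2
    have hR₁ := mid hR.1
    have hR₂ := mid hR.2
    rw [isIdempotentElem_triple_iff hI hΛ hmul] at he hf
    simp only [hmul, tripleMul, baseElem, baseTriple] at hw hL₁ hL₂ hR₁ hR₂
    -- The middle coordinate of `e` is an idempotent `L`-related to `y⁺`; commuting idempotents that
    -- are `L`-related coincide.
    rw [h.comm _ _ he (h.plus y).2, hL₂] at hL₁
    rw [h.comm _ _ (h.star y).2 hf, hR₂] at hR₁
    rw [hw, ← hL₁, ← hR₁, h.plus_mul_self, h.mul_star_self]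
  · rintro rfl
    -- The factorization is `(e, x, f) = (e, x⁺, x⁺)(x⁺, x, x^*)(x^*, x^*, f)`.
    refine ⟨plusTriple w, starTriple w, isIdempotentElem_plusTriple hI hΛ hmul w,
      isIdempotentElem_starTriple hI hΛ hmul w, ?_, ?_, ?_⟩
    · obtain ⟨⟨e, x, f⟩, hw⟩ := w
      obtain ⟨⟨h₁, -⟩, h₂, -⟩ := (mem_tripleSet hI hΛ).1 hw
      simp only at h₁ h₂
      simp only [Subtype.ext_iff, hmul, tripleMul, plusTriple, starTriple, baseElem, baseTriple,
        h.plus_mul_self, h.mul_star_self, h₁, h₂]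
    · rw [greenL_iff (isIdempotentElem_plusTriple hI hΛ hmul w)
        (isIdempotentElem_baseElem hI hΛ hmul _)]
      obtain ⟨⟨e, x, f⟩, hw⟩ := w
      obtain ⟨⟨h₁, -⟩, h₂, -⟩ := (mem_tripleSet hI hΛ).1 hw
      have hx : (h.plus x : S₀) * h.plus x = h.plus x := (h.plus x).2
      simp only at h₁ h₂
      simp only [Subtype.ext_iff, hmul, tripleMul, plusTriple, baseElem, baseTriple, hx,
        h.plus_coe, h.star_coe, h.map_idem, h₁, and_self]
    · rw [greenR_iff (isIdempotentElem_starTriple hI hΛ hmul w)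
        (isIdempotentElem_baseElem hI hΛ hmul _)]
      obtain ⟨⟨e, x, f⟩, hw⟩ := w
      obtain ⟨⟨h₁, -⟩, h₂, -⟩ := (mem_tripleSet hI hΛ).1 hw
      have hx : (h.star x : S₀) * h.star x = h.star x := (h.star x).2
      simp only at h₁ h₂
      simp only [Subtype.ext_iff, hmul, tripleMul, starTriple, baseElem, baseTriple, hx,
        h.plus_coe, h.star_coe, h.map_idem, h₂, and_self]

theorem isAdequateTransversal_baseHom (hI : IsLeftNormalBand I) (hΛ : IsRightNormalBand Λ)
    (hmul : ∀ a b : tripleSet h p q,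
      ((a * b : tripleSet h p q) : I × S₀ × Λ) = tripleMul h p q a b) :
    IsAdequateTransversal (baseHom hmul).srange where
  abundant := (isQuasiAdequate_tripleSet hI hΛ hmul).abundant
  adequate := h.of_mulEquiv (baseEquiv hmul)
  starSubsemigroup := isStarSubsemigroup_baseHom hI hΛ hmul
  existsUnique_bar w := by
    rw [(baseEquiv hmul).bijective.existsUnique_iff]
    simp only [h.plus_map, h.star_map, coe_baseEquiv, existsFactorization_iff hI hΛ hmul]
    exact existsUnique_eq

theorem bar_baseHom (hI : IsLeftNormalBand I) (hΛ : IsRightNormalBand Λ)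
    (hmul : ∀ a b : tripleSet h p q,
      ((a * b : tripleSet h p q) : I × S₀ × Λ) = tripleMul h p q a b) (w : tripleSet h p q) :
    (isAdequateTransversal_baseHom hI hΛ hmul).bar w =
      baseEquiv hmul (w : I × S₀ × Λ).2.1 := by
  have hT := isAdequateTransversal_baseHom hI hΛ hmul
  refine (hT.existsUnique_bar w).unique (hT.existsUnique_bar w).choose_spec.1 ?_
  simp only [h.plus_map, h.star_map, coe_baseEquiv, existsFactorization_iff hI hΛ hmul]

theorem isAdmissible_baseHom (hI : IsLeftNormalBand I) (hΛ : IsRightNormalBand Λ)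
    (hmul : ∀ a b : tripleSet h p q,
      ((a * b : tripleSet h p q) : I × S₀ × Λ) = tripleMul h p q a b) :
    (isAdequateTransversal_baseHom hI hΛ hmul).IsAdmissible := by
  intro a b
  rw [bar_baseHom hI hΛ, bar_baseHom hI hΛ, bar_baseHom hI hΛ, ← map_mul, hmul]
  rfl

theorem isQuasiIdeal_baseHom (hmul : ∀ a b : tripleSet h p q,
    ((a * b : tripleSet h p q) : I × S₀ × Λ) = tripleMul h p q a b) :
    IsQuasiIdeal (baseHom hmul).srange := by
  rintro _ ⟨x, rfl⟩ ⟨⟨e, s, f⟩, hs⟩ _ ⟨y, rfl⟩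
  refine ⟨x * s * y, Subtype.ext ?_⟩
  simp only [hmul, tripleMul, baseHom, MulHom.coe_mk, baseElem, baseTriple, Prod.mk.injEq,
    true_and]
  constructor
  · rw [← map_mul, ← map_mul, h.plus_mul_plus_mul, h.plus_mul_plus_mul]
  · rw [← map_mul, h.star_mul_mul_star]

end Construction

/-! ### The converse: recovering the bands and the triples from a transversal -/

namespace IsAdequateTransversal

variable {S : Type t} [Semigroup S] {T : Subsemigroup S} (hT : IsAdequateTransversal T)

theorem isIdempotentElem_coe (g : hT.adequate.idempotents) : IsIdempotentElem ((g : T) : S) :=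
  congrArg Subtype.val (IsIdempotentElem.eq g.2)

theorem coe_mul_comm (g k : hT.adequate.idempotents) :
    ((g : T) : S) * ((k : T) : S) = (k : T) * (g : T) :=
  congrArg Subtype.val (hT.adequate.comm g k g.2 k.2)

theorem coe_plus_mul_self (y : T) : ((hT.adequate.plus y : T) : S) * y = y :=
  congrArg Subtype.val (hT.adequate.plus_mul_self y)

theorem coe_mul_star_self (y : T) : (y : S) * ((hT.adequate.star y : T) : S) = y :=
  congrArg Subtype.val (hT.adequate.mul_star_self y)

/-- `e` is an idempotent `L`-related to the idempotent `g` of the transversal. -/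
def LeftOver (e : S) (g : hT.adequate.idempotents) : Prop :=
  IsIdempotentElem e ∧ e * (g : T) = e ∧ (g : T) * e = (g : T)

/-- `f` is an idempotent `R`-related to the idempotent `g` of the transversal. -/
def RightOver (f : S) (g : hT.adequate.idempotents) : Prop :=
  IsIdempotentElem f ∧ (g : T) * f = f ∧ f * (g : T) = (g : T)

variable {hT}

theorem leftOver_coe (g : hT.adequate.idempotents) : hT.LeftOver (g : T) g :=
  ⟨hT.isIdempotentElem_coe g, hT.isIdempotentElem_coe g, hT.isIdempotentElem_coe g⟩

theorem rightOver_coe (g : hT.adequate.idempotents) : hT.RightOver (g : T) g :=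
  ⟨hT.isIdempotentElem_coe g, hT.isIdempotentElem_coe g, hT.isIdempotentElem_coe g⟩

theorem bar_eq {y : T} {e f : S} (he : hT.LeftOver e (hT.adequate.plus y))
    (hf : hT.RightOver f (hT.adequate.star y)) : hT.bar (e * y * f) = y :=
  (hT.existsUnique_bar _).unique (hT.existsUnique_bar _).choose_spec.1
    ⟨e, f, he.1, hf.1, rfl, (greenL_iff he.1 (hT.isIdempotentElem_coe _)).2 he.2,
      (greenR_iff hf.1 (hT.isIdempotentElem_coe _)).2 hf.2⟩

theorem exists_eq_mul_bar_mul (x : S) :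
    ∃ (y : T) (e f : S), hT.LeftOver e (hT.adequate.plus y) ∧
      hT.RightOver f (hT.adequate.star y) ∧ x = e * y * f := by
  obtain ⟨y, ⟨e, f, he, hf, hx, hL, hR⟩, -⟩ := hT.existsUnique_bar x
  exact ⟨y, e, f, ⟨he, (greenL_iff he (hT.isIdempotentElem_coe _)).1 hL⟩,
    ⟨hf, (greenR_iff hf (hT.isIdempotentElem_coe _)).1 hR⟩, hx⟩

/-- Multiplying by `y^*` on the right removes `f` and leaves `ey = e'y`. Since `R*(T)` is restricted
from `S`, the relation `y R* y⁺` holds in `S` and turns this into `ey⁺ = e'y⁺`, that is `e = e'`. -/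
theorem mul_bar_mul_inj {y : T} {e f e' f' : S}
    (he : hT.LeftOver e (hT.adequate.plus y)) (hf : hT.RightOver f (hT.adequate.star y))
    (he' : hT.LeftOver e' (hT.adequate.plus y)) (hf' : hT.RightOver f' (hT.adequate.star y))
    (H : e * y * f = e' * y * f') : e = e' ∧ f = f' := by
  constructor
  · have h₁ : e * y = e' * y := by
      have := congrArg (· * ((hT.adequate.star y : T) : S)) H
      simpa only [mul_assoc, hf.2.2, hf'.2.2, hT.coe_mul_star_self] using this
    have hR := (hT.starSubsemigroup.rStar_iff _ _).1 (hT.adequate.plus_spec y)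
    have h₂ := ((rStar_iff.1 hR).1 e e').1 h₁
    rwa [he.2.1, he'.2.1] at h₂
  · have h₁ : y * f = y * f' := by
      have := congrArg (((hT.adequate.plus y : T) : S) * ·) H
      simpa only [← mul_assoc, he.2.2, he'.2.2, hT.coe_plus_mul_self] using this
    have hL := (hT.starSubsemigroup.lStar_iff _ _).1 (hT.adequate.star_spec y)
    have h₂ := ((lStar_iff.1 hL).1 f f').1 h₁
    rwa [hf.2.1, hf'.2.1] at h₂

theorem bar_coe (y : T) : hT.bar (y : S) = y := by
  have := bar_eq (hT := hT) (leftOver_coe (hT.adequate.plus y))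
    (rightOver_coe (hT.adequate.star y))
  rwa [hT.coe_plus_mul_self, hT.coe_mul_star_self] at this

/-- `e = e g g` is an admissible factorization, because `g⁺ = g = g^*`. -/
theorem LeftOver.bar {e : S} {g : hT.adequate.idempotents} (he : hT.LeftOver e g) :
    hT.bar e = g := by
  have := bar_eq (hT := hT) (y := (g : T)) (e := e) (f := (g : T)) (by rwa [IsAdequate.plus_coe])
    (by rw [IsAdequate.star_coe]; exact rightOver_coe g)
  rwa [he.2.1, he.2.1] at this

theorem RightOver.bar {f : S} {g : hT.adequate.idempotents} (hf : hT.RightOver f g) :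
    hT.bar f = g := by
  have := bar_eq (hT := hT) (y := (g : T)) (e := (g : T)) (f := f)
    (by rw [IsAdequate.plus_coe]; exact leftOver_coe g) (by rwa [IsAdequate.star_coe])
  rwa [(hT.isIdempotentElem_coe g).eq, hf.2.1] at this

/-- The crux of the converse: `fe = g(fe)k` is in `TST ⊆ T`, so it is its own bar. -/
theorem RightOver.mul_leftOver (hadm : hT.IsAdmissible) (hqi : IsQuasiIdeal T) {e f : S}
    {g k : hT.adequate.idempotents} (hf : hT.RightOver f g) (he : hT.LeftOver e k) :
    f * e = (g : T) * (k : T) := by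
  have hmem : f * e ∈ T := by
    have := hqi _ (g : T).2 (f * e) _ (k : T).2
    rwa [← mul_assoc, hf.2.1, mul_assoc, he.2.1] at this
  have h₁ : hT.bar (f * e) = ⟨f * e, hmem⟩ := bar_coe ⟨f * e, hmem⟩
  rw [hadm, hf.bar, he.bar] at h₁
  exact (congrArg Subtype.val h₁).symm

/-- `ee' = e(ge') = e(gg') = eg'`: only the leftmost factor of a product in the left band matters
beyond its image in `E(T)`. -/
theorem LeftOver.mul_eq (hadm : hT.IsAdmissible) (hqi : IsQuasiIdeal T) {e e' : S}
    {g g' : hT.adequate.idempotents} (he : hT.LeftOver e g) (he' : hT.LeftOver e' g') :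
    e * e' = e * (g' : T) := by
  rw [← he.2.1, mul_assoc, (rightOver_coe g).mul_leftOver hadm hqi he', mul_assoc]

theorem RightOver.mul_eq (hadm : hT.IsAdmissible) (hqi : IsQuasiIdeal T) {f f' : S}
    {g g' : hT.adequate.idempotents} (hf : hT.RightOver f g) (hf' : hT.RightOver f' g') :
    f * f' = (g : T) * f' := by
  rw [← hf'.2.1, ← mul_assoc, hf.mul_leftOver hadm hqi (leftOver_coe g'), mul_assoc]

theorem LeftOver.mul (hS : IsQuasiAdequate S) (hadm : hT.IsAdmissible) (hqi : IsQuasiIdeal T)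
    {e e' : S} {g g' : hT.adequate.idempotents} (he : hT.LeftOver e g)
    (he' : hT.LeftOver e' g') : hT.LeftOver (e * e') (g * g') := by
  refine ⟨hS.mul_idem _ _ he.1 he'.1, ?_, ?_⟩
  · change e * e' * (((g : T) : S) * (g' : T)) = e * e'
    rw [hT.coe_mul_comm, ← mul_assoc, mul_assoc e, he'.2.1, he.mul_eq hadm hqi he', mul_assoc,
      hT.coe_mul_comm, ← mul_assoc, he.2.1]
  · change ((g : T) : S) * (g' : T) * (e * e') = ((g : T) : S) * (g' : T)
    rw [he.mul_eq hadm hqi he', hT.coe_mul_comm, mul_assoc, ← mul_assoc _ e, he.2.2,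
      hT.coe_mul_comm g, ← mul_assoc, (hT.isIdempotentElem_coe g').eq]

theorem RightOver.mul (hS : IsQuasiAdequate S) (hadm : hT.IsAdmissible) (hqi : IsQuasiIdeal T)
    {f f' : S} {g g' : hT.adequate.idempotents} (hf : hT.RightOver f g)
    (hf' : hT.RightOver f' g') : hT.RightOver (f * f') (g * g') := by
  refine ⟨hS.mul_idem _ _ hf.1 hf'.1, ?_, ?_⟩
  · change ((g : T) : S) * (g' : T) * (f * f') = f * f'
    rw [hT.coe_mul_comm, mul_assoc, ← mul_assoc _ f, hf.2.1, hf.mul_eq hadm hqi hf', ← mul_assoc,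
      hT.coe_mul_comm, mul_assoc, hf'.2.1]
  · change f * f' * (((g : T) : S) * (g' : T)) = ((g : T) : S) * (g' : T)
    rw [hf.mul_eq hadm hqi hf', hT.coe_mul_comm, ← mul_assoc, mul_assoc _ f', hf'.2.2,
      hT.coe_mul_comm g, mul_assoc, (hT.isIdempotentElem_coe g).eq]

variable (hT)

/-- The idempotents that are `L`-related to an idempotent of the transversal. -/
def leftBand (hS : IsQuasiAdequate S) (hadm : hT.IsAdmissible) (hqi : IsQuasiIdeal T) :
    Subsemigroup S where
  carrier := {e | ∃ g, hT.LeftOver e g}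
  mul_mem' := fun ⟨g, he⟩ ⟨g', he'⟩ => ⟨g * g', he.mul hS hadm hqi he'⟩

/-- The idempotents that are `R`-related to an idempotent of the transversal. -/
def rightBand (hS : IsQuasiAdequate S) (hadm : hT.IsAdmissible) (hqi : IsQuasiIdeal T) :
    Subsemigroup S where
  carrier := {f | ∃ g, hT.RightOver f g}
  mul_mem' := fun ⟨g, hf⟩ ⟨g', hf'⟩ => ⟨g * g', hf.mul hS hadm hqi hf'⟩

/-- The embedding of the idempotents of the transversal in the left band. -/
def toLeftBand (hS : IsQuasiAdequate S) (hadm : hT.IsAdmissible) (hqi : IsQuasiIdeal T) :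
    hT.adequate.idempotents →ₙ* hT.leftBand hS hadm hqi where
  toFun g := ⟨(g : T), g, leftOver_coe g⟩
  map_mul' _ _ := rfl

/-- The embedding of the idempotents of the transversal in the right band. -/
def toRightBand (hS : IsQuasiAdequate S) (hadm : hT.IsAdmissible) (hqi : IsQuasiIdeal T) :
    hT.adequate.idempotents →ₙ* hT.rightBand hS hadm hqi where
  toFun g := ⟨(g : T), g, rightOver_coe g⟩
  map_mul' _ _ := rfl

variable (hS : IsQuasiAdequate S) (hadm : hT.IsAdmissible) (hqi : IsQuasiIdeal T)

/-- `xyz = xkl` with `k, l ∈ E(T)` lying under `y, z`, and `k, l` commute. -/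
theorem isLeftNormalBand_leftBand : IsLeftNormalBand (hT.leftBand hS hadm hqi) where
  idem := fun ⟨_, _, he⟩ => Subtype.ext he.1
  left_normal := by
    rintro ⟨x, g, hx⟩ ⟨y, k, hy⟩ ⟨z, l, hz⟩
    apply Subtype.ext
    change x * y * z = x * z * y
    rw [(hx.mul hS hadm hqi hy).mul_eq hadm hqi hz, (hx.mul hS hadm hqi hz).mul_eq hadm hqi hy,
      hx.mul_eq hadm hqi hy, hx.mul_eq hadm hqi hz, mul_assoc, hT.coe_mul_comm, mul_assoc]

theorem isRightNormalBand_rightBand : IsRightNormalBand (hT.rightBand hS hadm hqi) where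
  idem := fun ⟨_, _, hf⟩ => Subtype.ext hf.1
  right_normal := by
    rintro ⟨x, g, hx⟩ ⟨y, k, hy⟩ ⟨z, l, hz⟩
    apply Subtype.ext
    change x * y * z = y * x * z
    rw [mul_assoc, mul_assoc, hx.mul_eq hadm hqi (hy.mul hS hadm hqi hz),
      hy.mul_eq hadm hqi (hx.mul hS hadm hqi hz), hx.mul_eq hadm hqi hz, hy.mul_eq hadm hqi hz,
      ← mul_assoc, hT.coe_mul_comm, mul_assoc]

theorem embedsAsTransversal_toLeftBand : EmbedsAsTransversal (hT.toLeftBand hS hadm hqi) where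
  injective g k H := by
    have H' : ((g : T) : S) = (k : T) :=
      congrArg (fun w : hT.leftBand hS hadm hqi => (w : S)) H
    exact Subtype.ext (Subtype.ext H')
  transversal :=
    { idem := by
        rintro _ ⟨g, rfl⟩
        exact Subtype.ext (hT.isIdempotentElem_coe g)
      comm := by
        rintro _ ⟨g, rfl⟩ _ ⟨k, rfl⟩
        exact Subtype.ext (hT.coe_mul_comm g k)
      existsUnique_inverse := by
        rintro ⟨e, g, he⟩
        refine ⟨hT.toLeftBand hS hadm hqi g, ⟨⟨g, rfl⟩, Subtype.ext ?_, Subtype.ext ?_⟩, ?_⟩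
        · change e * (g : T) * e = e
          rw [he.2.1, he.1.eq]
        · change ((g : T) : S) * e * (g : T) = (g : T)
          rw [he.2.2, (hT.isIdempotentElem_coe g).eq]
        · rintro _ ⟨⟨y, rfl⟩, h₁, h₂⟩
          have h₁ : e * (y : T) * e = e := congrArg Subtype.val h₁
          have h₂ : ((y : T) : S) * e * (y : T) = (y : T) := congrArg Subtype.val h₂
          -- Premultiplying `eye = e` by `g` yields `yg = g`, so `g ≤ y`. Below, `ye = yg` turns
          -- `yey = y` into `y ≤ g`.
          have h₃ := congrArg (fun s => ((g : T) : S) * s) h₁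
          simp only [← mul_assoc, he.2.2] at h₃
          rw [hT.coe_mul_comm, mul_assoc, he.2.2] at h₃
          have h₄ : ((y : T) : S) * e = ((y : T) : S) * (g : T) :=
            (rightOver_coe y).mul_leftOver hadm hqi he
          rw [h₄, hT.coe_mul_comm, mul_assoc, (hT.isIdempotentElem_coe y).eq,
            hT.coe_mul_comm, h₃] at h₂
          exact Subtype.ext h₂.symm }

theorem embedsAsTransversal_toRightBand : EmbedsAsTransversal (hT.toRightBand hS hadm hqi) where
  injective g k H := by
    have H' : ((g : T) : S) = (k : T) :=
      congrArg (fun w : hT.rightBand hS hadm hqi => (w : S)) H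
    exact Subtype.ext (Subtype.ext H')
  transversal :=
    { idem := by
        rintro _ ⟨g, rfl⟩
        exact Subtype.ext (hT.isIdempotentElem_coe g)
      comm := by
        rintro _ ⟨g, rfl⟩ _ ⟨k, rfl⟩
        exact Subtype.ext (hT.coe_mul_comm g k)
      existsUnique_inverse := by
        rintro ⟨f, g, hf⟩
        refine ⟨hT.toRightBand hS hadm hqi g, ⟨⟨g, rfl⟩, Subtype.ext ?_, Subtype.ext ?_⟩, ?_⟩
        · change f * (g : T) * f = f
          rw [hf.2.2, hf.2.1]
        · change ((g : T) : S) * f * (g : T) = (g : T)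
          rw [hf.2.1, hf.2.2]
        · rintro _ ⟨⟨y, rfl⟩, h₁, h₂⟩
          have h₁ : f * (y : T) * f = f := congrArg Subtype.val h₁
          have h₂ : ((y : T) : S) * f * (y : T) = (y : T) := congrArg Subtype.val h₂
          have h₄ : f * (y : T) = ((g : T) : S) * (y : T) :=
            hf.mul_leftOver hadm hqi (leftOver_coe y)
          have h₃ := congrArg (fun s => s * ((g : T) : S)) h₁
          simp only [mul_assoc, hf.2.2] at h₃
          rw [hT.coe_mul_comm, ← mul_assoc, hf.2.2] at h₃
          rw [mul_assoc, h₄, hT.coe_mul_comm g, ← mul_assoc, (hT.isIdempotentElem_coe y).eq,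
            hT.coe_mul_comm, h₃] at h₂
          exact Subtype.ext h₂.symm }

/-- Green's relations taken inside the bands agree with those of `S` here, since between idempotents
both amount to the same two equations. -/
theorem mem_tripleSet_bands
    {w : hT.leftBand hS hadm hqi × T × hT.rightBand hS hadm hqi} :
    w ∈ tripleSet hT.adequate (hT.toLeftBand hS hadm hqi) (hT.toRightBand hS hadm hqi) ↔
      hT.LeftOver w.1 (hT.adequate.plus w.2.1) ∧ hT.RightOver w.2.2 (hT.adequate.star w.2.1) := by
  obtain ⟨⟨e, g, he⟩, y, ⟨f, k, hf⟩⟩ := w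
  rw [mem_tripleSet (hT.isLeftNormalBand_leftBand hS hadm hqi)
    (hT.isRightNormalBand_rightBand hS hadm hqi)]
  simp only [Subtype.ext_iff]
  exact and_congr ⟨fun H => ⟨he.1, H⟩, fun H => H.2⟩ ⟨fun H => ⟨hf.1, H⟩, fun H => H.2⟩

/-- The map `(e, y, f) ↦ e y f`. -/
def ofTriple
    (w : tripleSet hT.adequate (hT.toLeftBand hS hadm hqi) (hT.toRightBand hS hadm hqi)) : S :=
  w.1.1 * w.1.2.1 * w.1.2.2

theorem ofTriple_bijective : Function.Bijective (hT.ofTriple hS hadm hqi) := by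
  constructor
  · rintro ⟨⟨e, y, f⟩, hw⟩ ⟨⟨e', y', f'⟩, hw'⟩ H
    obtain ⟨he, hf⟩ := (hT.mem_tripleSet_bands hS hadm hqi).1 hw
    obtain ⟨he', hf'⟩ := (hT.mem_tripleSet_bands hS hadm hqi).1 hw'
    simp only [ofTriple] at he hf he' hf' H
    obtain rfl : y = y' := by rw [← bar_eq he hf, H, bar_eq he' hf']
    obtain ⟨h₁, h₂⟩ := mul_bar_mul_inj he hf he' hf' H
    obtain rfl := Subtype.ext h₁
    obtain rfl := Subtype.ext h₂
    rfl
  · intro x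
    obtain ⟨y, e, f, he, hf, rfl⟩ := exists_eq_mul_bar_mul (hT := hT) x
    exact ⟨⟨(⟨e, _, he⟩, y, ⟨f, _, hf⟩), (hT.mem_tripleSet_bands hS hadm hqi).2 ⟨he, hf⟩⟩, rfl⟩

theorem ofTriple_mul
    (a b c : tripleSet hT.adequate (hT.toLeftBand hS hadm hqi) (hT.toRightBand hS hadm hqi))
    (hc : (c : hT.leftBand hS hadm hqi × T × hT.rightBand hS hadm hqi) =
      tripleMul hT.adequate (hT.toLeftBand hS hadm hqi) (hT.toRightBand hS hadm hqi) a b) :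
    hT.ofTriple hS hadm hqi c = hT.ofTriple hS hadm hqi a * hT.ofTriple hS hadm hqi b := by
  obtain ⟨⟨e, y, f⟩, ha⟩ := a
  obtain ⟨⟨e', y', f'⟩, hb⟩ := b
  obtain ⟨-, hf⟩ := (hT.mem_tripleSet_bands hS hadm hqi).1 ha
  obtain ⟨he', -⟩ := (hT.mem_tripleSet_bands hS hadm hqi).1 hb
  simp only at hf he'
  have hmid := hf.mul_leftOver hadm hqi he'
  simp only [ofTriple, hc, tripleMul]
  change (e : S) * ((hT.adequate.plus (y * y') : T) : S) * ((y * y' : T) : S) *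
    (((hT.adequate.star (y * y') : T) : S) * f') = _
  rw [mul_assoc (e : S), hT.coe_plus_mul_self, ← mul_assoc, mul_assoc (e : S),
    hT.coe_mul_star_self]
  -- Insert `y = yy^*` and `y' = y'⁺y'`, then recognise `y^* y'⁺` as `fe'`.
  calc (e : S) * (y * y') * f'
      = e * (y * ((hT.adequate.star y : T) : S) * (((hT.adequate.plus y' : T) : S) * y')) * f' := by
        rw [hT.coe_mul_star_self, hT.coe_plus_mul_self]
    _ = e * (y * (((hT.adequate.star y : T) : S) * ((hT.adequate.plus y' : T) : S)) * y') * f' := by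
        simp only [mul_assoc]
    _ = _ := by rw [← hmid]; simp only [mul_assoc]

theorem ofTriple_baseElem (x : T) : hT.ofTriple hS hadm hqi
    (baseElem (hT.toLeftBand hS hadm hqi) (hT.toRightBand hS hadm hqi) x) = x := by
  change ((hT.adequate.plus x : T) : S) * x * ((hT.adequate.star x : T) : S) = x
  rw [hT.coe_plus_mul_self, hT.coe_mul_star_self]

end IsAdequateTransversal

end AdequateTransversal

/-! ### The structure theorem -/

open AdequateTransversal

theorem mainTheorem4 :
    (∀ (S₀ : Type u) (I : Type v) (Λ : Type w) [Semigroup S₀] [Semigroup I] [Semigroup Λ]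
        (h : AdequateTransversal.IsAdequate S₀)
        (_ : AdequateTransversal.IsLeftNormalBand I)
        (_ : AdequateTransversal.IsRightNormalBand Λ)
        (p : h.idempotents →ₙ* I) (q : h.idempotents →ₙ* Λ)
        (_ : AdequateTransversal.EmbedsAsTransversal p)
        (_ : AdequateTransversal.EmbedsAsTransversal q),
        ∃ _ : Semigroup (AdequateTransversal.tripleSet h p q),
          (∀ a b : AdequateTransversal.tripleSet h p q,
            ((a * b : AdequateTransversal.tripleSet h p q) : I × S₀ × Λ) =
              AdequateTransversal.tripleMul h p q a b) ∧
          AdequateTransversal.IsQuasiAdequate (AdequateTransversal.tripleSet h p q) ∧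
          ∃ (T : Subsemigroup (AdequateTransversal.tripleSet h p q))
            (hT : AdequateTransversal.IsAdequateTransversal T),
            hT.IsAdmissible ∧ AdequateTransversal.IsQuasiIdeal T ∧
            ∃ ψ : S₀ ≃* T, ∀ x : S₀,
              ((ψ x : AdequateTransversal.tripleSet h p q) : I × S₀ × Λ) =
                AdequateTransversal.baseTriple h p q x) ∧
    (∀ (S : Type t) [Semigroup S] (_ : AdequateTransversal.IsQuasiAdequate S)
        (T : Subsemigroup S) (hT : AdequateTransversal.IsAdequateTransversal T)
        (_ : hT.IsAdmissible) (_ : AdequateTransversal.IsQuasiIdeal T),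
        ∃ (I Λ : Type t) (_ : Semigroup I) (_ : Semigroup Λ)
          (p : hT.adequate.idempotents →ₙ* I) (q : hT.adequate.idempotents →ₙ* Λ),
          AdequateTransversal.IsLeftNormalBand I ∧
          AdequateTransversal.IsRightNormalBand Λ ∧
          AdequateTransversal.EmbedsAsTransversal p ∧
          AdequateTransversal.EmbedsAsTransversal q ∧
          ∃ _ : Semigroup (AdequateTransversal.tripleSet hT.adequate p q),
            (∀ a b : AdequateTransversal.tripleSet hT.adequate p q,
              ((a * b : AdequateTransversal.tripleSet hT.adequate p q) : I × T × Λ) =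
                AdequateTransversal.tripleMul hT.adequate p q a b) ∧
            ∃ φ : S ≃* AdequateTransversal.tripleSet hT.adequate p q, ∀ x : T,
              (φ (x : S) : I × T × Λ) =
                AdequateTransversal.baseTriple hT.adequate p q x) := by
  refine ⟨?_, ?_⟩
  · intro S₀ I Λ _ _ _ h hI hΛ p q _ _
    let _ := tripleSemigroup hI hΛ p q
    have hmul : ∀ a b : tripleSet h p q,
      ((a * b : tripleSet h p q) : I × S₀ × Λ) = tripleMul h p q a b := fun _ _ => rfl
    exact ⟨inferInstance, hmul, isQuasiAdequate_tripleSet hI hΛ hmul, (baseHom hmul).srange,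
      isAdequateTransversal_baseHom hI hΛ hmul, isAdmissible_baseHom hI hΛ hmul,
      isQuasiIdeal_baseHom hmul, baseEquiv hmul, fun _ => rfl⟩
  · intro S _ hS T hT hadm hqi
    have hI := hT.isLeftNormalBand_leftBand hS hadm hqi
    have hΛ := hT.isRightNormalBand_rightBand hS hadm hqi
    let _ := tripleSemigroup hI hΛ (hT.toLeftBand hS hadm hqi) (hT.toRightBand hS hadm hqi)
    -- The isomorphism is built from triples to `S`, where it has a formula, and then inverted; `x⁺
    -- x x^* = x` locates the image of `T`.
    let ψ : tripleSet hT.adequate (hT.toLeftBand hS hadm hqi) (hT.toRightBand hS hadm hqi) ≃* S :=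
      MulEquiv.ofBijective
        (MulHom.mk (hT.ofTriple hS hadm hqi) fun a b => hT.ofTriple_mul hS hadm hqi a b _ rfl)
        (hT.ofTriple_bijective hS hadm hqi)
    refine ⟨hT.leftBand hS hadm hqi, hT.rightBand hS hadm hqi, inferInstance, inferInstance,
      hT.toLeftBand hS hadm hqi, hT.toRightBand hS hadm hqi, hI, hΛ,
      hT.embedsAsTransversal_toLeftBand hS hadm hqi,
      hT.embedsAsTransversal_toRightBand hS hadm hqi, inferInstance, fun _ _ => rfl,
      ψ.symm, fun x => ?_⟩
    have hx : ψ.symm (x : S) = baseElem _ _ x :=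
      ψ.symm_apply_eq.2 (hT.ofTriple_baseElem hS hadm hqi x).symm
    exact congrArg Subtype.val hx
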